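/- Let $X$ be a scheme. A commutative Picard category is a symmetric monoidal groupoid $(\mathscr C,+,0)$ in which $P+(-)$ and $(-)+P$ are equivalences for every object $P$; write $c(x,y):x+y\to y+x$ for its commutativity isomorphism. A bracket functor on $X$ with values in $\mathscr C$ is a functor $[-]$ from vector bundles on $X$ and their isomorphisms to $\mathscr C$, with an isomorphism $\Sigma:[E_2]\to[E_1]+[E_3]$ for every exact sequence $0\to E_1\to E_2\to E_3\to 0$ of vector bundles, natural for isomorphisms of exact sequences, and an isomorphism $z:[0]\to 0$, such that: for $0\to 0\to E\xrightarrow{=}E\to 0$ the composite $[E]\xrightarrow{\Sigma}[0]+[E]\xrightarrow{z}0+[E]\to[E]$ is the identity; for subbundles $E_1\subseteq E_2\subseteq E_3$ the two maps $[E_3]\to[E_1]+[E_2/E_1]+[E_3/E_2]$ obtained from $\Sigma$ through $[E_1]+[E_3/E_1]$ and through $[E_2]+[E_3/E_2]$ agree; and the two maps $\Sigma:[E_1\oplus E_2]\to[E_1]+[E_2]$ and $\Sigma:[E_1\oplus E_2]\to[E_2]+[E_1]$ differ by $c([E_1],[E_2])$. Let $V(\mathrm{Vect}(X))$, the category of virtual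 vector bundles over $X$, be the commutative Picard category with the universal bracket functor on $X$. Write $E$ for $[E]$; associativity isomorphisms are left implicit, and every unlabelled arrow below is induced by $\Sigma$ for the corresponding exact sequence. In each of the following cases all objects are vector bundles on $X$, there are given maps $V_1\to V_2$, $W_1\to W_2$, $V_1\to W_1$, $V_2\to W_2$, and the diagram formed by these maps together with the listed rows and columns commutes (with $i=1,2$). (1) Suppose the rows $0\to V_1\to V_2\to C\to 0$, $0\to W_1\to W_2\to C\to 0$ and the columns $0\to K\to V_i\to W_i\to 0$ are exact, with identity maps on $K$ and on $C$. Then the composites $V_2\to K+W_2\to K+W_1+C$ and $V_2\to V_1+C\to K+W_1+C$ are equal. (2) Suppose the rows $0\to V_1\to V_2\to C\to 0$, $0\to W_1\to W_2\to C\to 0$ and the columns $0\to V_i\to W_i\to D\to 0$ are exact, with identity maps on $C$ and on $D$. Then the composites $W_2\to V_2+D\to V_1+C+D\xrightarrow{c(C,D)}V_1+D+C$ and $W_2\to W_1+C\to V_1+D+C$ are equal. (3) Suppose the rows $0\to T\to V_1\to V_2\to 0$, $0\to T\to W_1\to W_2\to 0$ and the columns $0\to K\to V_i\to W_i\to 0$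 are exact, with identity maps on $T$ and on $K$. Then the composites $V_1\to T+V_2\to T+K+W_2\xrightarrow{c(T,K)}K+T+W_2$ and $V_1\to K+W_1\to K+T+W_2$ are equal. (4) Suppose the rows $0\to K\to V_1\to V_2\to 0$, $0\to K\to W_1\to W_2\to 0$ and the columns $0\to V_i\to W_i\to C\to 0$ are exact, with identity maps on $K$ and on $C$. Then the composites $W_1\to K+W_2\to K+V_2+C$ and $W_1\to V_1+C\to K+V_2+C$ are equal. -/

import Mathlib

open CategoryTheory Limits MonoidalCategory
open AlgebraicGeometry AlgebraicGeometry.Scheme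
open scoped ZeroObject

universe u

noncomputable section

namespace AlgebraicGeometry.Scheme

/-- The structure sheaf of `X` as a module over itself. -/
def structureModule (X : Scheme.{u}) : X.Modules := SheafOfModules.unit X.ringCatSheaf

/-- The free module of rank `n` on `X`. -/
abbrev freeModule (X : Scheme.{u}) (n : ℕ) : X.Modules := ∐ fun _ : Fin n => X.structureModule

/-- Locally free of finite (locally constant) rank. -/
def isVectorBundle (X : Scheme.{u}) : ObjectProperty X.Modules := fun E =>
  ∀ x : X, ∃ U : X.Opens, x ∈ U ∧ ∃ n : ℕ, Nonempty (E.restrict U.ι ≅ U.toScheme.freeModule n)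

instance (X : Scheme.{u}) : X.isVectorBundle.IsClosedUnderIsomorphisms where
  of_iso e h x := by
    obtain ⟨U, hx, n, ⟨i⟩⟩ := h x
    exact ⟨U, hx, n, ⟨(Modules.restrictFunctor U.ι).mapIso e.symm ≪≫ i⟩⟩

theorem isZero_freeModule_zero (X : Scheme.{u}) : IsZero (X.freeModule 0) :=
  (IsZero.iff_id_eq_zero _).2 (Sigma.hom_ext _ _ fun i => i.elim0)

theorem isVectorBundle_of_isZero {X : Scheme.{u}} {E : X.Modules} (h : IsZero E) :
    X.isVectorBundle E := fun _ =>
  ⟨⊤, trivial, 0, ⟨(Functor.map_isZero (Modules.restrictFunctor _) h).iso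
    (isZero_freeModule_zero _)⟩⟩

theorem nonempty_restrict_freeModule_iso {X Y : Scheme.{u}} (f : X ⟶ Y) [IsOpenImmersion f]
    (n : ℕ) : Nonempty ((Y.freeModule n).restrict f ≅ X.freeModule n) :=
  ⟨PreservesCoproduct.iso (Modules.restrictFunctor f) _ ≪≫
    Sigma.mapIso fun _ => Modules.restrictUnitIso f⟩

theorem nonempty_freeModule_biprod_iso (X : Scheme.{u}) (m n : ℕ) :
    Nonempty (X.freeModule m ⊞ X.freeModule n ≅ X.freeModule (m + n)) :=
  ⟨(biprod.isoCoprod _ _) ≪≫ (coprodIsCoprod _ _).coconePointUniqueUpToIso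
    (mapIsColimitOfPreservesOfIsColimit (sigmaConst.obj X.structureModule) _ _
      (Types.binaryCoproductColimit (Fin m) (Fin n))) ≪≫
    (sigmaConst.obj X.structureModule).mapIso finSumFinEquiv.toIso⟩

theorem isVectorBundle_biprod {X : Scheme.{u}} {E F : X.Modules} (hE : X.isVectorBundle E)
    (hF : X.isVectorBundle F) : X.isVectorBundle (E ⊞ F) := by
  intro x
  obtain ⟨U, hU, m, ⟨i⟩⟩ := hE x
  obtain ⟨V, hV, n, ⟨j⟩⟩ := hF x
  obtain ⟨k⟩ := nonempty_freeModule_biprod_iso (U ⊓ V).toScheme m n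
  have aux : ∀ {G : X.Modules} {W : X.Opens} {l : ℕ} (h : U ⊓ V ≤ W)
      (_ : G.restrict W.ι ≅ W.toScheme.freeModule l),
      Nonempty (G.restrict (U ⊓ V).ι ≅ (U ⊓ V).toScheme.freeModule l) := by
    intro G W l h e
    obtain ⟨r⟩ := nonempty_restrict_freeModule_iso (X.homOfLE h) l
    exact ⟨(Modules.restrictFunctorCongr (X.homOfLE_ι h).symm).app G ≪≫
      (Modules.restrictFunctorComp _ _).app G ≪≫
      (Modules.restrictFunctor (X.homOfLE h)).mapIso e ≪≫ r⟩
  obtain ⟨i'⟩ := aux inf_le_left i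
  obtain ⟨j'⟩ := aux inf_le_right j
  have : PreservesBinaryBiproducts (Modules.restrictFunctor (U ⊓ V).ι) :=
    preservesBinaryBiproducts_of_preservesBinaryCoproducts _
  exact ⟨U ⊓ V, ⟨hU, hV⟩, m + n,
    ⟨(Modules.restrictFunctor (U ⊓ V).ι).mapBiprod E F ≪≫ biprod.mapIso i' j' ≪≫ k⟩⟩

/-- The category of vector bundles on `X`. -/
abbrev Vect (X : Scheme.{u}) := X.isVectorBundle.FullSubcategory

namespace Vect

variable {X : Scheme.{u}}

/-- `0 ⟶ E₁ ⟶ E₂ ⟶ E₃ ⟶ 0` is exact as a sequence of `𝒪_X`-modules. -/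
def IsExactSeq {E₁ E₂ E₃ : X.Vect} (f : E₁ ⟶ E₂) (g : E₂ ⟶ E₃) : Prop :=
  ∃ w : f.hom ≫ g.hom = 0, (ShortComplex.mk f.hom g.hom w).ShortExact

/-- The zero vector bundle. -/
def zero (X : Scheme.{u}) : X.Vect := ⟨0, isVectorBundle_of_isZero (isZero_zero X.Modules)⟩

/-- The direct sum of two vector bundles. -/
def sum (E F : X.Vect) : X.Vect := ⟨E.obj ⊞ F.obj, isVectorBundle_biprod E.property F.property⟩

/-- The inclusion of the first summand. -/
def inl (E F : X.Vect) : E ⟶ E.sum F := ObjectProperty.homMk biprod.inl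
/-- The inclusion of the second summand. -/
def inr (E F : X.Vect) : F ⟶ E.sum F := ObjectProperty.homMk biprod.inr
/-- The projection to the first summand. -/
def fst (E F : X.Vect) : E.sum F ⟶ E := ObjectProperty.homMk biprod.fst
/-- The projection to the second summand. -/
def snd (E F : X.Vect) : E.sum F ⟶ F := ObjectProperty.homMk biprod.snd

theorem isZero_zero_obj (X : Scheme.{u}) : IsZero (zero X).obj := isZero_zero X.Modules

theorem isExactSeq_zero (E : X.Vect) :
    IsExactSeq (ObjectProperty.homMk 0 : zero X ⟶ E) (𝟙 E) :=
  ⟨zero_comp, .mk' (ShortComplex.exact_of_f_is_kernel _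
      (KernelFork.IsLimit.ofMonoOfIsZero _ (inferInstanceAs (Mono (𝟙 E.obj))) (isZero_zero_obj X)))
    ⟨fun _ _ _ => (isZero_zero_obj X).eq_of_tgt _ _⟩ (inferInstanceAs (Epi (𝟙 E.obj)))⟩

theorem isExactSeq_inl_snd (E F : X.Vect) : IsExactSeq (inl E F) (snd E F) :=
  ⟨biprod.inl_snd, ShortComplex.Splitting.shortExact
    ⟨biprod.fst, biprod.inr, biprod.inl_fst, biprod.inr_snd, biprod.total⟩⟩

theorem isExactSeq_inr_fst (E F : X.Vect) : IsExactSeq (inr E F) (fst E F) :=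
  ⟨biprod.inr_fst, ShortComplex.Splitting.shortExact
    ⟨biprod.snd, biprod.inl, biprod.inr_snd, biprod.inl_fst, (add_comm _ _).trans biprod.total⟩⟩

/-- A monomorphism of `𝒪_X`-modules between vector bundles is the inclusion of a subbundle if its
cokernel is again a vector bundle. -/
structure IsSubbundle {E F : X.Vect} (i : E ⟶ F) : Prop where
  mono : Mono i.hom
  isVectorBundle_cokernel : X.isVectorBundle (cokernel i.hom)

/-- The quotient bundle `F / E`. -/
def IsSubbundle.quotient {E F : X.Vect} {i : E ⟶ F} (h : IsSubbundle i) : X.Vect :=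
  ⟨cokernel i.hom, h.isVectorBundle_cokernel⟩

/-- The projection `F ⟶ F / E`. -/
def IsSubbundle.proj {E F : X.Vect} {i : E ⟶ F} (h : IsSubbundle i) : F ⟶ h.quotient :=
  ObjectProperty.homMk (cokernel.π i.hom)

theorem IsSubbundle.isExactSeq {E F : X.Vect} {i : E ⟶ F} (h : IsSubbundle i) :
    IsExactSeq i h.proj :=
  have := h.mono
  ⟨cokernel.condition _, .mk' (ShortComplex.exact_cokernel _) h.mono
    (inferInstanceAs (Epi (cokernel.π i.hom)))⟩

section

variable {E₁ E₂ E₃ : X.Vect} {i : E₁ ⟶ E₂} {j : E₂ ⟶ E₃}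

/-- The inclusion `E₂ / E₁ ⟶ E₃ / E₁`. -/
def quotientInclusion (hi : IsSubbundle i) (hij : IsSubbundle (i ≫ j)) :
    hi.quotient ⟶ hij.quotient :=
  ObjectProperty.homMk (cokernel.map i.hom (i ≫ j).hom (𝟙 _) j.hom (by simp))

/-- The projection `E₃ / E₁ ⟶ E₃ / E₂`. -/
def quotientProjection (hij : IsSubbundle (i ≫ j)) (hj : IsSubbundle j) :
    hij.quotient ⟶ hj.quotient :=
  ObjectProperty.homMk (cokernel.map (i ≫ j).hom j.hom i.hom (𝟙 _) (by simp))

theorem isExactSeq_quotient (hi : IsSubbundle i) (hj : IsSubbundle j)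
    (hij : IsSubbundle (i ≫ j)) :
    IsExactSeq (quotientInclusion hi hij) (quotientProjection hij hj) := by
  have := hj.mono
  have h := kernelCokernelCompSequence_exact i.hom j.hom
  refine ⟨(kernelCokernelCompSequence.snakeInput i.hom j.hom).L₃.zero, .mk' (h.exact 3) ?_ ?_⟩
  · refine (h.exact 2).mono_g ((isZero_kernel_of_mono j.hom).eq_of_src _ _)
  · exact inferInstanceAs (Epi ((kernelCokernelCompSequence i.hom j.hom).map' 4 5))

end
end Vect

/-- A commutative Picard category: a symmetric monoidal groupoid (its tensor product is written
`+` in the literature, its unit `0`) in which adding any object, on either side, is an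
equivalence. -/
class IsPicardCategory (C : Type*) [Groupoid C] [MonoidalCategory C] : Prop where
  isEquivalence_tensorLeft : ∀ P : C, (tensorLeft P).IsEquivalence
  isEquivalence_tensorRight : ∀ P : C, (tensorRight P).IsEquivalence

/-- A bracket functor on `X` with values in a commutative Picard category `C`. -/
structure BracketFunctor (X : Scheme.{u}) (C : Type*) [Groupoid C] [MonoidalCategory C]
    [SymmetricCategory C] [IsPicardCategory C] where
  /-- The functor `E ↦ [E]` on vector bundles and their isomorphisms. -/
  functor : Core X.Vect ⥤ C
  /-- `Σ : [E₂] ⟶ [E₁] + [E₃]`. -/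
  sigma {E₁ E₂ E₃ : X.Vect} (f : E₁ ⟶ E₂) (g : E₂ ⟶ E₃) (h : Vect.IsExactSeq f g) :
    functor.obj ⟨E₂⟩ ⟶ functor.obj ⟨E₁⟩ ⊗ functor.obj ⟨E₃⟩
  sigma_naturality {E₁ E₂ E₃ F₁ F₂ F₃ : X.Vect} (f : E₁ ⟶ E₂) (g : E₂ ⟶ E₃)
    (h : Vect.IsExactSeq f g) (f' : F₁ ⟶ F₂) (g' : F₂ ⟶ F₃) (h' : Vect.IsExactSeq f' g')
    (e₁ : E₁ ≅ F₁) (e₂ : E₂ ≅ F₂) (e₃ : E₃ ≅ F₃) (_ : f ≫ e₂.hom = e₁.hom ≫ f')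
    (_ : g ≫ e₃.hom = e₂.hom ≫ g') :
    functor.map ⟨e₂⟩ ≫ sigma f' g' h' =
      sigma f g h ≫ (functor.map ⟨e₁⟩ ⊗ₘ functor.map ⟨e₃⟩)
  /-- `z : [0] ⟶ 0`. -/
  zeroHom : functor.obj ⟨Vect.zero X⟩ ⟶ 𝟙_ C
  sigma_zero (E : X.Vect) :
    sigma _ _ (Vect.isExactSeq_zero E) ≫ zeroHom ▷ functor.obj ⟨E⟩ ≫ (λ_ (functor.obj ⟨E⟩)).hom =
      𝟙 _
  sigma_filtration {E₁ E₂ E₃ : X.Vect} (i : E₁ ⟶ E₂) (j : E₂ ⟶ E₃) (hi : Vect.IsSubbundle i)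
    (hj : Vect.IsSubbundle j) (hij : Vect.IsSubbundle (i ≫ j)) :
    sigma _ _ hij.isExactSeq ≫
        functor.obj ⟨E₁⟩ ◁ sigma _ _ (Vect.isExactSeq_quotient hi hj hij) =
      sigma _ _ hj.isExactSeq ≫ sigma _ _ hi.isExactSeq ▷ functor.obj ⟨hj.quotient⟩ ≫
        (α_ _ _ _).hom
  sigma_sum (E₁ E₂ : X.Vect) :
    sigma _ _ (Vect.isExactSeq_inl_snd E₁ E₂) ≫ (β_ _ _).hom =
      sigma _ _ (Vect.isExactSeq_inr_fst E₁ E₂)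

/-- The category of virtual vector bundles on `X` is the commutative Picard category freely generated
by a bracket functor on `X`, constructed by generators and relations. Its objects are formal
expressions in brackets of
vector bundles, a unit, sums and negatives. -/
inductive VirtualBundle (X : Scheme.{u}) : Type (u + 1)
  | bracket (E : X.Vect) : VirtualBundle X
  | unit : VirtualBundle X
  | add (A B : VirtualBundle X) : VirtualBundle X
  | neg (A : VirtualBundle X) : VirtualBundle X

namespace VirtualBundle

/-- Formal morphisms between virtual vector bundles: words in the structure isomorphisms of a
commutative Picard category with a bracket functor on `X` and their formal inverses. -/
inductive PreHom {X : Scheme.{u}} : VirtualBundle X → VirtualBundle X → Type (u + 1)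
  | ident (A : VirtualBundle X) : PreHom A A
  | comp {A B C : VirtualBundle X} (f : PreHom A B) (g : PreHom B C) : PreHom A C
  | inv {A B : VirtualBundle X} (f : PreHom A B) : PreHom B A
  | add {A B C D : VirtualBundle X} (f : PreHom A B) (g : PreHom C D) : PreHom (A.add C) (B.add D)
  | assoc (A B C : VirtualBundle X) : PreHom ((A.add B).add C) (A.add (B.add C))
  | comm (A B : VirtualBundle X) : PreHom (A.add B) (B.add A)
  | unitAdd (A : VirtualBundle X) : PreHom (unit.add A) A
  | addUnit (A : VirtualBundle X) : PreHom (A.add unit) A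
  | addNeg (A : VirtualBundle X) : PreHom (A.add A.neg) unit
  | map {E F : X.Vect} (e : E ≅ F) : PreHom (bracket E) (bracket F)
  | sigma {E₁ E₂ E₃ : X.Vect} (f : E₁ ⟶ E₂) (g : E₂ ⟶ E₃) (h : Vect.IsExactSeq f g) :
      PreHom (bracket E₂) ((bracket E₁).add (bracket E₃))
  | zero : PreHom (bracket (Vect.zero X)) unit

open PreHom in
/-- The smallest congruence on formal morphisms for which the axioms of a commutative Picard
category with a bracket functor on `X` hold. -/
inductive Rel {X : Scheme.{u}} : ∀ {A B : VirtualBundle X}, PreHom A B → PreHom A B → Prop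
  -- an equivalence relation compatible with the operations on morphisms
  | refl {A B : VirtualBundle X} (f : PreHom A B) : Rel f f
  | symm {A B : VirtualBundle X} {f g : PreHom A B} : Rel f g → Rel g f
  | trans {A B : VirtualBundle X} {f g h : PreHom A B} : Rel f g → Rel g h → Rel f h
  | comp_congr {A B C : VirtualBundle X} {f f' : PreHom A B} {g g' : PreHom B C} :
      Rel f f' → Rel g g' → Rel (f.comp g) (f'.comp g')
  | inv_congr {A B : VirtualBundle X} {f f' : PreHom A B} : Rel f f' → Rel f.inv f'.inv
  | add_congr {A B C D : VirtualBundle X} {f f' : PreHom A B} {g g' : PreHom C D} :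
      Rel f f' → Rel g g' → Rel (f.add g) (f'.add g')
  -- groupoid
  | id_comp {A B : VirtualBundle X} (f : PreHom A B) : Rel ((ident A).comp f) f
  | comp_id {A B : VirtualBundle X} (f : PreHom A B) : Rel (f.comp (ident B)) f
  | comp_assoc {A B C D : VirtualBundle X} (f : PreHom A B) (g : PreHom B C) (h : PreHom C D) :
      Rel ((f.comp g).comp h) (f.comp (g.comp h))
  | comp_inv {A B : VirtualBundle X} (f : PreHom A B) : Rel (f.comp f.inv) (ident A)
  | inv_comp {A B : VirtualBundle X} (f : PreHom A B) : Rel (f.inv.comp f) (ident B)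
  -- bifunctoriality of the sum
  | id_add_id (A B : VirtualBundle X) : Rel ((ident A).add (ident B)) (ident (A.add B))
  | add_comp_add {A₁ A₂ A₃ B₁ B₂ B₃ : VirtualBundle X} (f₁ : PreHom A₁ A₂) (g₁ : PreHom B₁ B₂)
      (f₂ : PreHom A₂ A₃) (g₂ : PreHom B₂ B₃) :
      Rel ((f₁.add g₁).comp (f₂.add g₂)) ((f₁.comp f₂).add (g₁.comp g₂))
  -- naturality of the associativity, commutativity and unit isomorphisms, and their coherence
  | assoc_naturality {A₁ A₂ A₃ B₁ B₂ B₃ : VirtualBundle X} (f₁ : PreHom A₁ B₁) (f₂ : PreHom A₂ B₂)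
      (f₃ : PreHom A₃ B₃) :
      Rel (((f₁.add f₂).add f₃).comp (assoc B₁ B₂ B₃))
        ((assoc A₁ A₂ A₃).comp (f₁.add (f₂.add f₃)))
  | comm_naturality {A₁ A₂ B₁ B₂ : VirtualBundle X} (f₁ : PreHom A₁ B₁) (f₂ : PreHom A₂ B₂) :
      Rel ((f₁.add f₂).comp (comm B₁ B₂)) ((comm A₁ A₂).comp (f₂.add f₁))
  | unitAdd_naturality {A B : VirtualBundle X} (f : PreHom A B) :
      Rel (((ident unit).add f).comp (unitAdd B)) ((unitAdd A).comp f)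
  | addUnit_naturality {A B : VirtualBundle X} (f : PreHom A B) :
      Rel ((f.add (ident unit)).comp (addUnit B)) ((addUnit A).comp f)
  | pentagon (A B C D : VirtualBundle X) :
      Rel (((assoc A B C).add (ident D)).comp ((assoc A (B.add C) D).comp ((ident A).add (assoc B C D))))
        ((assoc (A.add B) C D).comp (assoc A B (C.add D)))
  | triangle (A B : VirtualBundle X) :
      Rel ((assoc A unit B).comp ((ident A).add (unitAdd B))) ((addUnit A).add (ident B))
  | hexagon (A B C : VirtualBundle X) :
      Rel ((assoc A B C).comp ((comm A (B.add C)).comp (assoc B C A)))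
        (((comm A B).add (ident C)).comp ((assoc B A C).comp ((ident B).add (comm A C))))
  | symmetry (A B : VirtualBundle X) : Rel ((comm A B).comp (comm B A)) (ident (A.add B))
  -- the bracket functor
  | map_id (E : X.Vect) : Rel (map (Iso.refl E)) (ident (bracket E))
  | map_comp {E F G : X.Vect} (e : E ≅ F) (e' : F ≅ G) : Rel (map (e ≪≫ e')) ((map e).comp (map e'))
  | sigma_naturality {E₁ E₂ E₃ F₁ F₂ F₃ : X.Vect} (f : E₁ ⟶ E₂) (g : E₂ ⟶ E₃)
      (h : Vect.IsExactSeq f g) (f' : F₁ ⟶ F₂) (g' : F₂ ⟶ F₃) (h' : Vect.IsExactSeq f' g')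
      (e₁ : E₁ ≅ F₁) (e₂ : E₂ ≅ F₂) (e₃ : E₃ ≅ F₃) (_ : f ≫ e₂.hom = e₁.hom ≫ f')
      (_ : g ≫ e₃.hom = e₂.hom ≫ g') :
      Rel ((map e₂).comp (sigma f' g' h')) ((sigma f g h).comp ((map e₁).add (map e₃)))
  | sigma_zero (E : X.Vect) :
      Rel ((sigma _ _ (Vect.isExactSeq_zero E)).comp
        ((zero.add (ident (bracket E))).comp (unitAdd (bracket E)))) (ident (bracket E))
  | sigma_filtration {E₁ E₂ E₃ : X.Vect} (i : E₁ ⟶ E₂) (j : E₂ ⟶ E₃) (hi : Vect.IsSubbundle i)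
      (hj : Vect.IsSubbundle j) (hij : Vect.IsSubbundle (i ≫ j)) :
      Rel ((sigma _ _ hij.isExactSeq).comp
          ((ident (bracket E₁)).add (sigma _ _ (Vect.isExactSeq_quotient hi hj hij))))
        ((sigma _ _ hj.isExactSeq).comp
          (((sigma _ _ hi.isExactSeq).add (ident (bracket hj.quotient))).comp (assoc _ _ _)))
  | sigma_sum (E₁ E₂ : X.Vect) :
      Rel ((sigma _ _ (Vect.isExactSeq_inl_snd E₁ E₂)).comp (comm _ _))
        (sigma _ _ (Vect.isExactSeq_inr_fst E₁ E₂))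

variable {X : Scheme.{u}}

instance setoid (A B : VirtualBundle X) : Setoid (PreHom A B) :=
  ⟨Rel, ⟨Rel.refl, Rel.symm, Rel.trans⟩⟩

instance : Groupoid (VirtualBundle X) where
  Hom A B := Quotient (setoid A B)
  id A := ⟦PreHom.ident A⟧
  comp := Quotient.map₂ PreHom.comp fun _ _ hf _ _ hg => Rel.comp_congr hf hg
  inv := Quotient.map PreHom.inv fun _ _ hf => Rel.inv_congr hf
  id_comp := by rintro _ _ ⟨f⟩; exact Quotient.sound (Rel.id_comp f)
  comp_id := by rintro _ _ ⟨f⟩; exact Quotient.sound (Rel.comp_id f)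
  assoc := by rintro _ _ _ _ ⟨f⟩ ⟨g⟩ ⟨h⟩; exact Quotient.sound (Rel.comp_assoc f g h)
  inv_comp := by rintro _ _ ⟨f⟩; exact Quotient.sound (Rel.inv_comp f)
  comp_inv := by rintro _ _ ⟨f⟩; exact Quotient.sound (Rel.comp_inv f)

/-- The morphism represented by a formal morphism. -/
def homMk {A B : VirtualBundle X} (f : PreHom A B) : A ⟶ B := ⟦f⟧

/-- The isomorphism represented by a formal morphism. -/
def isoMk {A B : VirtualBundle X} (f : PreHom A B) : A ≅ B where
  hom := homMk f
  inv := homMk f.inv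
  hom_inv_id := Quotient.sound (Rel.comp_inv f)
  inv_hom_id := Quotient.sound (Rel.inv_comp f)

/-- The sum of two morphisms. -/
def addHom {A B C D : VirtualBundle X} (f : A ⟶ B) (g : C ⟶ D) : A.add C ⟶ B.add D :=
  Quotient.map₂ PreHom.add (fun _ _ hf _ _ hg => Rel.add_congr hf hg) f g

instance : MonoidalCategoryStruct (VirtualBundle X) where
  tensorObj := add
  tensorUnit := unit
  tensorHom := addHom
  whiskerLeft A _ _ f := addHom (𝟙 A) f
  whiskerRight f B := addHom f (𝟙 B)
  associator A B C := isoMk (PreHom.assoc A B C)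
  leftUnitor A := isoMk (PreHom.unitAdd A)
  rightUnitor A := isoMk (PreHom.addUnit A)

instance : MonoidalCategory (VirtualBundle X) := .ofTensorHom
  (id_tensorHom_id := fun A B => Quotient.sound (Rel.id_add_id A B))
  (id_tensorHom := fun _ _ _ _ => rfl)
  (tensorHom_id := fun _ _ => rfl)
  (tensorHom_comp_tensorHom := by
    rintro _ _ _ _ _ _ ⟨f₁⟩ ⟨g₁⟩ ⟨f₂⟩ ⟨g₂⟩; exact Quotient.sound (Rel.add_comp_add f₁ g₁ f₂ g₂))
  (associator_naturality := by
    rintro _ _ _ _ _ _ ⟨f₁⟩ ⟨f₂⟩ ⟨f₃⟩; exact Quotient.sound (Rel.assoc_naturality f₁ f₂ f₃))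
  (leftUnitor_naturality := by rintro _ _ ⟨f⟩; exact Quotient.sound (Rel.unitAdd_naturality f))
  (rightUnitor_naturality := by rintro _ _ ⟨f⟩; exact Quotient.sound (Rel.addUnit_naturality f))
  (pentagon := fun A B C D => Quotient.sound (Rel.pentagon A B C D))
  (triangle := fun A B => Quotient.sound (Rel.triangle A B))

/-- The commutativity isomorphism. -/
def commIso (A B : VirtualBundle X) : A ⊗ B ≅ B ⊗ A where
  hom := homMk (PreHom.comm A B)
  inv := homMk (PreHom.comm B A)
  hom_inv_id := Quotient.sound (Rel.symmetry A B)
  inv_hom_id := Quotient.sound (Rel.symmetry B A)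

theorem hexagon (A B C : VirtualBundle X) :
    (α_ A B C).hom ≫ (commIso A (B ⊗ C)).hom ≫ (α_ B C A).hom =
      (commIso A B).hom ▷ C ≫ (α_ B A C).hom ≫ B ◁ (commIso A C).hom :=
  Quotient.sound (Rel.hexagon A B C)

instance : SymmetricCategory (VirtualBundle X) where
  braiding := commIso
  braiding_naturality_right := by
    rintro A _ _ ⟨f⟩; exact Quotient.sound (Rel.comm_naturality (PreHom.ident A) f)
  braiding_naturality_left := by
    rintro _ _ ⟨f⟩ A; exact Quotient.sound (Rel.comm_naturality f (PreHom.ident A))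
  hexagon_forward := hexagon
  hexagon_reverse A B C := by
    have h := congrArg (fun f => CategoryTheory.inv f) (hexagon C A B)
    have e (P Q : VirtualBundle X) : (commIso P Q).inv = (commIso Q P).hom := rfl
    simpa [e] using h
  symmetry A B := (commIso A B).hom_inv_id

/-- `A + (-A) ≅ 0`. -/
def addNegIso (A : VirtualBundle X) : A ⊗ A.neg ≅ 𝟙_ (VirtualBundle X) := isoMk (PreHom.addNeg A)

instance : IsPicardCategory (VirtualBundle X) where
  isEquivalence_tensorLeft P :=
    (CategoryTheory.Equivalence.mk (tensorLeft P) (tensorLeft P.neg)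
      ((leftUnitorNatIso _).symm ≪≫ (tensoringLeft _).mapIso ((addNegIso P).symm ≪≫ β_ _ _) ≪≫
        tensorLeftTensor _ _)
      ((tensorLeftTensor _ _).symm ≪≫ (tensoringLeft _).mapIso (addNegIso P) ≪≫
        leftUnitorNatIso _)).isEquivalence_functor
  isEquivalence_tensorRight P :=
    (CategoryTheory.Equivalence.mk (tensorRight P) (tensorRight P.neg)
      ((rightUnitorNatIso _).symm ≪≫ (tensoringRight _).mapIso (addNegIso P).symm ≪≫
        tensorRightTensor _ _)
      ((tensorRightTensor _ _).symm ≪≫ (tensoringRight _).mapIso (β_ _ _ ≪≫ addNegIso P) ≪≫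
        rightUnitorNatIso _)).isEquivalence_functor

/-- The canonical bracket functor `[-]` of the category of virtual vector bundles. -/
def bracketFunctor (X : Scheme.{u}) : BracketFunctor X (VirtualBundle X) where
  functor :=
    { obj := fun E => bracket E.of
      map := fun e => homMk (PreHom.map e.iso)
      map_id := fun E => Quotient.sound (Rel.map_id E.of)
      map_comp := fun e e' => Quotient.sound (Rel.map_comp e.iso e'.iso) }
  sigma f g h := homMk (PreHom.sigma f g h)
  sigma_naturality f g h f' g' h' e₁ e₂ e₃ w w' :=
    Quotient.sound (Rel.sigma_naturality f g h f' g' h' e₁ e₂ e₃ w w')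
  zeroHom := homMk PreHom.zero
  sigma_zero E := Quotient.sound (Rel.sigma_zero E)
  sigma_filtration i j hi hj hij := Quotient.sound (Rel.sigma_filtration i j hi hj hij)
  sigma_sum E₁ E₂ := Quotient.sound (Rel.sigma_sum E₁ E₂)

/-- The isomorphism `Σ : [E₂] ⟶ [E₁] + [E₃]` of virtual vector bundles given by an exact sequence
`0 ⟶ E₁ ⟶ E₂ ⟶ E₃ ⟶ 0`. -/
abbrev sigma {E₁ E₂ E₃ : X.Vect} {f : E₁ ⟶ E₂} {g : E₂ ⟶ E₃} (h : Vect.IsExactSeq f g) :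
    bracket E₂ ⟶ bracket E₁ ⊗ bracket E₃ :=
  (bracketFunctor X).sigma f g h

end VirtualBundle

end AlgebraicGeometry.Scheme

end

open AlgebraicGeometry.Scheme.VirtualBundle (bracket sigma)

/-! All four identities hold for every bracket functor; the universality of $V(\mathrm{Vect}(X))$
plays no role. Everything rests on the filtration axiom, restated in `sigma_comp_sigma` for
arbitrary quotients in place of chosen cokernels. Cases (1) and (4) are that axiom for $K\subseteq
V_1\subseteq V_2$ (quotients $W_1$, $W_2$, $C$) and for $K\subseteq V_1\subseteq W_1$ (quotients
$V_2$, $W_2$, $C$). In case (2), $V_1=V_2\cap W_1$ inside $W_2$ and $W_2/V_1\cong C\oplus D$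
(`biprod_lift`). The filtrations $V_1\subseteq V_2\subseteq W_2$ and $V_1\subseteq W_1\subseteq W_2$
then factor through the same $\Sigma:W_2\to V_1+(C\oplus D)$, and differ only in how $C\oplus D$ is
split; the direct sum axiom says that this difference is $c(C,D)$. Case (3) is dual: $K\oplus T$ is
a subbundle of $V_1$ with quotient $W_2$ (`biprod_desc`), and the filtrations through $T$ and
through $K$ differ only in how $K\oplus T$ is split. -/

/-! ### Two short exact sequences in an abelian category -/

namespace CategoryTheory.ShortComplex.ShortExact

variable {𝒜 : Type*} [Category* 𝒜] [Abelian 𝒜]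

/-- If `V₂` and `W₁` are subobjects of `W₂` with intersection `V₁` and sum `W₂`, then
`W₂ / V₁` is the direct sum of `W₂ / W₁` and `W₂ / V₂`. -/
theorem biprod_lift {V₁ V₂ W₂ C D : 𝒜} {v : V₁ ⟶ V₂} {v' : V₂ ⟶ C} {w' : W₂ ⟶ C} {i₂ : V₂ ⟶ W₂}
    {d₂ : W₂ ⟶ D} {zV : v ≫ v' = 0} {z₂ : i₂ ≫ d₂ = 0}
    (hV : (ShortComplex.mk v v' zV).ShortExact) (h₂ : (ShortComplex.mk i₂ d₂ z₂).ShortExact)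
    (hv' : i₂ ≫ w' = v') :
    ∃ z, (ShortComplex.mk (v ≫ i₂) (biprod.lift w' d₂) z).ShortExact := by
  have : Mono v := hV.mono_f
  have : Mono i₂ := h₂.mono_f
  have : Epi v' := hV.epi_g
  have : Epi d₂ := h₂.epi_g
  have : Epi (biprod.lift w' d₂) := by
    -- In terms of elements: lift the $D$-component of `y` to `x` in $W_2$, then correct the
    -- $C$-component by an element `x'` of $V_2$, which does not change the image in $D$.
    refine (epi_iff_surjective_up_to_refinements _).2 fun A y => ?_
    obtain ⟨A', π, hπ, x, hx⟩ := surjective_up_to_refinements_of_epi d₂ (y ≫ biprod.snd)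
    obtain ⟨A'', π', hπ', x', hx'⟩ := surjective_up_to_refinements_of_epi v'
      (π ≫ y ≫ biprod.fst - x ≫ w')
    refine ⟨A'', π' ≫ π, inferInstance, x' ≫ i₂ + π' ≫ x, ?_⟩
    refine biprod.hom_ext _ _ ?_ ?_
    · simp [hv', ← hx']
    · simp [hx, z₂]
  have z : (v ≫ i₂) ≫ biprod.lift w' d₂ = 0 :=
    biprod.hom_ext _ _ (by simp [hv', zV]) (by simp [z₂])
  refine ⟨z, .mk' (exact_of_f_is_kernel _ (KernelFork.IsLimit.ofι' _ _ fun {A} a ha => ?_))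
    (inferInstanceAs (Mono (v ≫ i₂))) this⟩
  have ha₁ : a ≫ w' = 0 := by simpa using ha =≫ biprod.fst
  have ha₂ : a ≫ d₂ = 0 := by simpa using ha =≫ biprod.snd
  -- A map killed by `d₂` factors through $V_2$; being also killed by `w'`, which restricts to `v'`,
  -- it factors further through $V_1$.
  have hb : h₂.exact.lift a ha₂ ≫ i₂ = a := h₂.exact.lift_f a ha₂
  have hc : h₂.exact.lift a ha₂ ≫ v' = 0 := by rw [← hv', reassoc_of% hb, ha₁]
  exact ⟨hV.exact.lift _ hc, by
    have : hV.exact.lift _ hc ≫ v = _ := hV.exact.lift_f _ hc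
    exact (Category.assoc _ _ _).symm.trans ((congrArg (· ≫ i₂) this).trans hb)⟩

/-- If `K` and `T` are subobjects of `V₁` such that `K` maps isomorphically to a subobject of
`V₂ = V₁ / T`, then `K ⊕ T` is a subobject of `V₁`, with quotient `V₂ / K`. -/
theorem biprod_desc {K T V₁ V₂ W₂ : 𝒜} {t₁ : T ⟶ V₁} {v : V₁ ⟶ V₂} {k₁ : K ⟶ V₁} {k₂ : K ⟶ V₂}
    {p₂ : V₂ ⟶ W₂} {zV : t₁ ≫ v = 0} {z₂ : k₂ ≫ p₂ = 0}
    (hV : (ShortComplex.mk t₁ v zV).ShortExact) (h₂ : (ShortComplex.mk k₂ p₂ z₂).ShortExact)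
    (hk : k₁ ≫ v = k₂) :
    ∃ z, (ShortComplex.mk (biprod.desc k₁ t₁) (v ≫ p₂) z).ShortExact := by
  have : Mono t₁ := hV.mono_f
  have : Mono k₂ := h₂.mono_f
  have : Epi v := hV.epi_g
  have : Epi p₂ := h₂.epi_g
  -- Modulo $T$ only the $K$-component survives. Since `k₂` is mono, this component of any element
  -- of the kernel vanishes, and then `t₁` being mono kills the other one.
  have hd : biprod.desc k₁ t₁ ≫ v = biprod.fst ≫ k₂ :=
    biprod.hom_ext' _ _ (by simp [hk]) (by simp [zV])
  have : Mono (biprod.desc k₁ t₁) := by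
    refine Preadditive.mono_of_cancel_zero _ fun {A} y hy => ?_
    have h₁ : y ≫ biprod.fst = 0 := by
      rw [← cancel_mono k₂, Category.assoc, ← hd, reassoc_of% hy, zero_comp, zero_comp]
    rw [biprod.desc_eq, Preadditive.comp_add, reassoc_of% h₁, zero_comp, zero_add,
      ← Category.assoc] at hy
    exact biprod.hom_ext _ _ (by simpa using h₁) (by simpa using zero_of_comp_mono _ hy)
  have z : biprod.desc k₁ t₁ ≫ v ≫ p₂ = 0 := by rw [reassoc_of% hd, z₂, comp_zero]
  refine ⟨z, .mk' (exact_of_g_is_cokernel _ (CokernelCofork.IsColimit.ofπ' _ _ fun {A} a ha => ?_))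
    this (inferInstanceAs (Epi (v ≫ p₂)))⟩
  have ha₁ : k₁ ≫ a = 0 := by simpa using biprod.inl ≫= ha
  have ha₂ : t₁ ≫ a = 0 := by simpa using biprod.inr ≫= ha
  -- A map vanishing on $T$ descends to $V_2$; as it also vanishes on $K$, it descends further to
  -- $W_2$.
  have hb : v ≫ hV.exact.desc a ha₂ = a := hV.exact.g_desc a ha₂
  have hc : k₂ ≫ hV.exact.desc a ha₂ = 0 := by rw [← hk, Category.assoc, hb, ha₁]
  exact ⟨h₂.exact.desc _ hc, by
    have : p₂ ≫ h₂.exact.desc _ hc = _ := h₂.exact.g_desc _ hc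
    exact (Category.assoc _ _ _).trans ((congrArg (v ≫ ·) this).trans hb)⟩

end CategoryTheory.ShortComplex.ShortExact

/-! ### Exact sequences of vector bundles -/

namespace AlgebraicGeometry.Scheme

namespace Vect

variable {X : Scheme.{u}}

namespace IsExactSeq

variable {E₁ E₂ E₃ : X.Vect} {f : E₁ ⟶ E₂} {g : E₂ ⟶ E₃}

theorem comp_eq_zero (h : IsExactSeq f g) : f.hom ≫ g.hom = 0 := h.1

/-- An exact sequence of vector bundles is isomorphic to the one given by a subbundle and its
quotient bundle. -/
theorem exists_quotient_iso (h : IsExactSeq f g) :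
    ∃ (hf : IsSubbundle f) (e : hf.quotient ≅ E₃), hf.proj ≫ e.hom = g := by
  obtain ⟨w, hs⟩ := h
  let i : cokernel f.hom ≅ E₃.obj :=
    (cokernelIsCokernel f.hom).coconePointUniqueUpToIso hs.gIsCokernel
  have hi : cokernel.π f.hom ≫ i.hom = g.hom :=
    (cokernelIsCokernel f.hom).comp_coconePointUniqueUpToIso_hom hs.gIsCokernel
      WalkingParallelPair.one
  refine ⟨⟨hs.mono_f, X.isVectorBundle.prop_of_iso i.symm E₃.property⟩,
    ObjectProperty.isoMk _ i, ?_⟩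
  ext1
  exact hi

end IsExactSeq

theorem isExactSeq_lift {V₁ V₂ W₂ C D : X.Vect} {v : V₁ ⟶ V₂} {v' : V₂ ⟶ C}
    {w' : W₂ ⟶ C} {i₂ : V₂ ⟶ W₂} {d₂ : W₂ ⟶ D}
    (hV : IsExactSeq v v') (h₂ : IsExactSeq i₂ d₂) (hv' : i₂ ≫ w' = v') :
    IsExactSeq (v ≫ i₂) (ObjectProperty.homMk (biprod.lift w'.hom d₂.hom) : W₂ ⟶ C.sum D) :=
  hV.2.biprod_lift h₂.2 (congrArg (·.hom) hv')

theorem isExactSeq_desc {K T V₁ V₂ W₂ : X.Vect} {t₁ : T ⟶ V₁} {v : V₁ ⟶ V₂}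
    {k₁ : K ⟶ V₁} {k₂ : K ⟶ V₂} {p₂ : V₂ ⟶ W₂}
    (hV : IsExactSeq t₁ v) (h₂ : IsExactSeq k₂ p₂) (hk : k₁ ≫ v = k₂) :
    IsExactSeq (ObjectProperty.homMk (biprod.desc k₁.hom t₁.hom) : K.sum T ⟶ V₁) (v ≫ p₂) :=
  hV.2.biprod_desc h₂.2 (congrArg (·.hom) hk)

end Vect

/-! ### Identities valid for every bracket functor -/

namespace BracketFunctor

open Vect

variable {X : Scheme.{u}} {𝒞 : Type*} [Groupoid 𝒞] [MonoidalCategory 𝒞] [SymmetricCategory 𝒞]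
  [IsPicardCategory 𝒞] (B : BracketFunctor X 𝒞)

/-- Naturality of $\Sigma$ with identities on the first two terms. It serves to pass from the
cokernel of a subbundle to any other model of the quotient. -/
theorem sigma_comp_iso {E₁ E₂ E₃ F₃ : X.Vect} {f : E₁ ⟶ E₂} {g : E₂ ⟶ E₃} {g' : E₂ ⟶ F₃}
    (h : IsExactSeq f g) (h' : IsExactSeq f g') (e : E₃ ≅ F₃) (w : g ≫ e.hom = g') :
    B.sigma f g' h' = B.sigma f g h ≫ B.functor.obj ⟨E₁⟩ ◁ B.functor.map ⟨e⟩ := by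
  have hid (E : X.Vect) : B.functor.map (X := ⟨E⟩) ⟨Iso.refl E⟩ = 𝟙 _ := B.functor.map_id _
  have := B.sigma_naturality f g h f g' h' (Iso.refl _) (Iso.refl _) e (by simp) (by simpa using w)
  rwa [hid, hid, Category.id_comp, id_tensorHom] at this

/-- The compatibility of `Σ` with a two-step filtration `E₁ ⊆ E₂ ⊆ E₃`, for arbitrary choices of
the quotient bundles `Q₁ = E₂ / E₁`, `Q = E₃ / E₁`, `Q₂ = E₃ / E₂`. -/
theorem sigma_comp_sigma {E₁ E₂ E₃ Q₁ Q Q₂ : X.Vect} {i : E₁ ⟶ E₂} {p : E₂ ⟶ Q₁} {j : E₂ ⟶ E₃}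
    {q : E₃ ⟶ Q₂} {k : E₁ ⟶ E₃} {r : E₃ ⟶ Q} {a : Q₁ ⟶ Q} {b : Q ⟶ Q₂}
    (hi : IsExactSeq i p) (hj : IsExactSeq j q) (hk : IsExactSeq k r) (ha : IsExactSeq a b)
    (hij : i ≫ j = k) (hpa : p ≫ a = j ≫ r) (hrb : r ≫ b = q) :
    B.sigma k r hk ≫ B.functor.obj ⟨E₁⟩ ◁ B.sigma a b ha =
      B.sigma j q hj ≫ B.sigma i p hi ▷ B.functor.obj ⟨Q₂⟩ ≫ (α_ _ _ _).hom := by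
  subst hij
  obtain ⟨si, e₁, he₁⟩ := hi.exists_quotient_iso
  obtain ⟨sj, e₂, he₂⟩ := hj.exists_quotient_iso
  obtain ⟨sk, e, he⟩ := hk.exists_quotient_iso
  -- Maps out of a quotient bundle are thus determined on the bundle above it, which reduces the two
  -- squares required for `hn` to the given equations.
  have hπ {E F : X.Vect} {f : E ⟶ F} (s : IsSubbundle f) : Epi s.proj :=
    ⟨fun u v huv => by
      ext1
      exact (cancel_epi (cokernel.π f.hom)).1 (congrArg (·.hom) huv)⟩
  have hinc : si.proj ≫ quotientInclusion si sk = j ≫ sk.proj := by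
    ext1
    exact cokernel.π_desc _ _ _
  have hproj : sk.proj ≫ quotientProjection sk sj = sj.proj := by
    ext1
    exact (cokernel.π_desc _ _ _).trans (Category.id_comp _)
  have hn := B.sigma_naturality _ _ (isExactSeq_quotient si sj sk) a b ha e₁ e e₂
    (by
      have := hπ si
      rw [← cancel_epi si.proj, reassoc_of% hinc, he, reassoc_of% he₁, hpa])
    (by
      have := hπ sk
      rw [← cancel_epi sk.proj, reassoc_of% hproj, he₂, reassoc_of% he, hrb])
  rw [B.sigma_comp_iso sk.isExactSeq hk e he, B.sigma_comp_iso si.isExactSeq hi e₁ he₁,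
    B.sigma_comp_iso sj.isExactSeq hj e₂ he₂, Category.assoc, ← whiskerLeft_comp, hn,
    whiskerLeft_comp, ← Category.assoc, B.sigma_filtration i j si sj sk]
  -- What remains is the interchange law, sliding the map induced by `e₂` past $\Sigma$ for `i`.
  simp [tensorHom_def', whisker_exchange_assoc]

/-- Both sides refine $\Sigma$ for $0\to V_1\to W_2\to C\oplus D\to 0$: one by the sequence $C\to
C\oplus D\to D$, the other by $D\to C\oplus D\to C$. The axiom `sigma_sum` compares these two. -/
theorem sigma_comp_sigma_of_intersection {V₁ V₂ W₁ W₂ C D : X.Vect} {v : V₁ ⟶ V₂} {v' : V₂ ⟶ C}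
    {w : W₁ ⟶ W₂} {w' : W₂ ⟶ C} {i₁ : V₁ ⟶ W₁} {i₂ : V₂ ⟶ W₂} {d₁ : W₁ ⟶ D} {d₂ : W₂ ⟶ D}
    (hV : IsExactSeq v v') (hW : IsExactSeq w w') (h₁ : IsExactSeq i₁ d₁) (h₂ : IsExactSeq i₂ d₂)
    (hvi : v ≫ i₂ = i₁ ≫ w) (hv' : i₂ ≫ w' = v') (hd : w ≫ d₂ = d₁) :
    B.sigma i₂ d₂ h₂ ≫ B.sigma v v' hV ▷ B.functor.obj ⟨D⟩ ≫ (α_ _ _ _).hom ≫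
        B.functor.obj ⟨V₁⟩ ◁ (β_ (B.functor.obj ⟨C⟩) (B.functor.obj ⟨D⟩)).hom =
      B.sigma w w' hW ≫ B.sigma i₁ d₁ h₁ ▷ B.functor.obj ⟨C⟩ ≫ (α_ _ _ _).hom := by
  have hk := isExactSeq_lift hV h₂ hv'
  have hV₂ := B.sigma_comp_sigma hV h₂ hk (isExactSeq_inl_snd C D) rfl
    (by
      ext1
      change v'.hom ≫ biprod.inl = i₂.hom ≫ biprod.lift w'.hom d₂.hom
      exact biprod.hom_ext _ _ (by simpa using (congrArg (·.hom) hv').symm)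
        (by simpa using h₂.comp_eq_zero.symm))
    (by ext1; exact biprod.lift_snd _ _)
  have hW₁ := B.sigma_comp_sigma h₁ hW hk (isExactSeq_inr_fst C D) hvi.symm
    (by
      ext1
      change d₁.hom ≫ biprod.inr = w.hom ≫ biprod.lift w'.hom d₂.hom
      exact biprod.hom_ext _ _ (by simpa using hW.comp_eq_zero.symm)
        (by simpa using (congrArg (·.hom) hd).symm))
    (by ext1; exact biprod.lift_fst _ _)
  rw [← hW₁, ← B.sigma_sum, whiskerLeft_comp, reassoc_of% hV₂]

/-- Both sides refine $\Sigma$ for $0\to K\oplus T\to V_1\to W_2\to 0$, now by splitting the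
subobject $K\oplus T$ in the two possible orders. -/
theorem sigma_comp_sigma_of_sum {K T V₁ V₂ W₁ W₂ : X.Vect} {t₁ : T ⟶ V₁} {v : V₁ ⟶ V₂}
    {t₂ : T ⟶ W₁} {w : W₁ ⟶ W₂} {k₁ : K ⟶ V₁} {k₂ : K ⟶ V₂} {p₁ : V₁ ⟶ W₁} {p₂ : V₂ ⟶ W₂}
    (hV : IsExactSeq t₁ v) (hW : IsExactSeq t₂ w) (h₁ : IsExactSeq k₁ p₁) (h₂ : IsExactSeq k₂ p₂)
    (hk : k₁ ≫ v = k₂) (ht : t₁ ≫ p₁ = t₂) (hvp : v ≫ p₂ = p₁ ≫ w) :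
    B.sigma t₁ v hV ≫ B.functor.obj ⟨T⟩ ◁ B.sigma k₂ p₂ h₂ ≫ (α_ _ _ _).inv ≫
        (β_ (B.functor.obj ⟨T⟩) (B.functor.obj ⟨K⟩)).hom ▷ B.functor.obj ⟨W₂⟩ =
      B.sigma k₁ p₁ h₁ ≫ B.functor.obj ⟨K⟩ ◁ B.sigma t₂ w hW ≫ (α_ _ _ _).inv := by
  have hj := isExactSeq_desc hV h₂ hk
  have hT := B.sigma_comp_sigma (isExactSeq_inr_fst K T) hj hV h₂
    (by ext1; exact biprod.inr_desc _ _)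
    (by
      ext1
      change biprod.fst ≫ k₂.hom = biprod.desc k₁.hom t₁.hom ≫ v.hom
      exact biprod.hom_ext' _ _ (by simpa using (congrArg (·.hom) hk).symm)
        (by simpa using hV.comp_eq_zero.symm))
    rfl
  have hK := B.sigma_comp_sigma (isExactSeq_inl_snd K T) hj h₁ hW
    (by ext1; exact biprod.inl_desc _ _)
    (by
      ext1
      change biprod.snd ≫ t₂.hom = biprod.desc k₁.hom t₁.hom ≫ p₁.hom
      exact biprod.hom_ext' _ _ (by simpa using h₁.comp_eq_zero.symm)
        (by simpa using (congrArg (·.hom) ht).symm))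
    hvp.symm
  -- `sigma_sum` introduces $c(K,T)$, which cancels against the $c(T,K)$ of the statement because
  -- the braiding is symmetric.
  rw [reassoc_of% hT, reassoc_of% hK, ← B.sigma_sum]
  simp [← comp_whiskerRight]

end BracketFunctor

end AlgebraicGeometry.Scheme

theorem mainTheorem11 (X : Scheme.{u}) :
    -- type (1): columns `K ⟶ V₁ ⟶ W₁`, `K ⟶ V₂ ⟶ W₂`, rows `V₁ ⟶ V₂ ⟶ C`, `W₁ ⟶ W₂ ⟶ C`
    (∀ {K V₁ V₂ W₁ W₂ C : X.Vect} {k₁ : K ⟶ V₁} {k₂ : K ⟶ V₂} {v : V₁ ⟶ V₂} {v' : V₂ ⟶ C}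
      {w : W₁ ⟶ W₂} {w' : W₂ ⟶ C} {p₁ : V₁ ⟶ W₁} {p₂ : V₂ ⟶ W₂}
      (hV : Vect.IsExactSeq v v') (hW : Vect.IsExactSeq w w')
      (h₁ : Vect.IsExactSeq k₁ p₁) (h₂ : Vect.IsExactSeq k₂ p₂),
      k₁ ≫ v = k₂ → v ≫ p₂ = p₁ ≫ w → p₂ ≫ w' = v' →
      sigma h₂ ≫ bracket K ◁ sigma hW =
        sigma hV ≫ sigma h₁ ▷ bracket C ≫ (α_ (bracket K) (bracket W₁) (bracket C)).hom) ∧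
    -- type (2): columns `V₁ ⟶ W₁ ⟶ D`, `V₂ ⟶ W₂ ⟶ D`, rows `V₁ ⟶ V₂ ⟶ C`, `W₁ ⟶ W₂ ⟶ C`
    (∀ {V₁ V₂ W₁ W₂ C D : X.Vect} {v : V₁ ⟶ V₂} {v' : V₂ ⟶ C} {w : W₁ ⟶ W₂} {w' : W₂ ⟶ C}
      {i₁ : V₁ ⟶ W₁} {i₂ : V₂ ⟶ W₂} {d₁ : W₁ ⟶ D} {d₂ : W₂ ⟶ D}
      (hV : Vect.IsExactSeq v v') (hW : Vect.IsExactSeq w w')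
      (h₁ : Vect.IsExactSeq i₁ d₁) (h₂ : Vect.IsExactSeq i₂ d₂),
      v ≫ i₂ = i₁ ≫ w → i₂ ≫ w' = v' → w ≫ d₂ = d₁ →
      sigma h₂ ≫ sigma hV ▷ bracket D ≫ (α_ (bracket V₁) (bracket C) (bracket D)).hom ≫
          bracket V₁ ◁ (β_ (bracket C) (bracket D)).hom =
        sigma hW ≫ sigma h₁ ▷ bracket C ≫ (α_ (bracket V₁) (bracket D) (bracket C)).hom) ∧
    -- type (3): columns `K ⟶ V₁ ⟶ W₁`, `K ⟶ V₂ ⟶ W₂`, rows `T ⟶ V₁ ⟶ V₂`, `T ⟶ W₁ ⟶ W₂`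
    (∀ {K T V₁ V₂ W₁ W₂ : X.Vect} {t₁ : T ⟶ V₁} {v : V₁ ⟶ V₂} {t₂ : T ⟶ W₁} {w : W₁ ⟶ W₂}
      {k₁ : K ⟶ V₁} {k₂ : K ⟶ V₂} {p₁ : V₁ ⟶ W₁} {p₂ : V₂ ⟶ W₂}
      (hV : Vect.IsExactSeq t₁ v) (hW : Vect.IsExactSeq t₂ w)
      (h₁ : Vect.IsExactSeq k₁ p₁) (h₂ : Vect.IsExactSeq k₂ p₂),
      k₁ ≫ v = k₂ → t₁ ≫ p₁ = t₂ → v ≫ p₂ = p₁ ≫ w →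
      sigma hV ≫ bracket T ◁ sigma h₂ ≫ (α_ (bracket T) (bracket K) (bracket W₂)).inv ≫
          (β_ (bracket T) (bracket K)).hom ▷ bracket W₂ =
        sigma h₁ ≫ bracket K ◁ sigma hW ≫ (α_ (bracket K) (bracket T) (bracket W₂)).inv) ∧
    -- type (4): columns `V₁ ⟶ W₁ ⟶ C`, `V₂ ⟶ W₂ ⟶ C`, rows `K ⟶ V₁ ⟶ V₂`, `K ⟶ W₁ ⟶ W₂`
    (∀ {K V₁ V₂ W₁ W₂ C : X.Vect} {k₁ : K ⟶ V₁} {v : V₁ ⟶ V₂} {k₂ : K ⟶ W₁} {w : W₁ ⟶ W₂}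
      {i₁ : V₁ ⟶ W₁} {i₂ : V₂ ⟶ W₂} {c₁ : W₁ ⟶ C} {c₂ : W₂ ⟶ C}
      (hV : Vect.IsExactSeq k₁ v) (hW : Vect.IsExactSeq k₂ w)
      (h₁ : Vect.IsExactSeq i₁ c₁) (h₂ : Vect.IsExactSeq i₂ c₂),
      k₁ ≫ i₁ = k₂ → v ≫ i₂ = i₁ ≫ w → w ≫ c₂ = c₁ →
      sigma hW ≫ bracket K ◁ sigma h₂ =
        sigma h₁ ≫ sigma hV ▷ bracket C ≫ (α_ (bracket K) (bracket V₂) (bracket C)).hom) := by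
  let B := VirtualBundle.bracketFunctor X
  refine ⟨fun hV hW h₁ h₂ hk hvp hpw => ?_, fun hV hW h₁ h₂ hvi hv' hd => ?_,
    fun hV hW h₁ h₂ hk ht hvp => ?_, fun hV hW h₁ h₂ hk hvi hwc => ?_⟩
  -- The filtration $K\subseteq V_1\subseteq V_2$.
  · exact B.sigma_comp_sigma h₁ hV h₂ hW hk hvp.symm hpw
  · exact B.sigma_comp_sigma_of_intersection hV hW h₁ h₂ hvi hv' hd
  · exact B.sigma_comp_sigma_of_sum hV hW h₁ h₂ hk ht hvp
  -- The filtration $K\subseteq V_1\subseteq W_1$.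
  · exact B.sigma_comp_sigma hV h₁ hW h₂ hk hvi hwc
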